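/- Let $(\mathscr A,\tau)$ be a $W^\star$-non-commutative probability space ($\mathscr A$ a von Neumann algebra with a faithful tracial state $\tau$), let $P\in\mathscr A$ be an orthogonal projection, $\theta=\tau(P)$, $S=2P-1$ and $\kappa=\tau(S)=2\theta-1$. Let $U\in\mathscr A$ be a Haar unitary ($\tau(U^k)=0$ for all $k\in\mathbb Z\setminus\{0\}$) that is $\star$-free from $P$. Let $\mu_\infty$ be the spectral distribution of the unitary operator $SUSU^\star$, that is, the unique probability measure on the unit circle $\mathbb T$ with $\int_{\mathbb T}z^n\,\mu_\infty(dz)=\tau\big((SUSU^\star)^n\big)$ for all $n\ge 0$. Then the Lebesgue decomposition of $\mu_\infty$ with respect to the Haar measure of $\mathbb T$ is $$ \mu_\infty=|\kappa|\,\delta_1+\sqrt{1-\frac{\kappa^2}{\sin^2(\psi/2)}}\;\mathbf 1_{\{|\sin(\psi/2)|\ge|\kappa|\}}\,\frac{d\psi}{2\pi},\qquad z=e^{i\psi},\ \psi\in(-\pi,\pi]. $$ That is, $\mu_\infty$ is the sum of an atom of mass $|\kappa|$ at $1$ and of an absolutely continuous part, carried by the two arcs $\{e^{\pm i\psi}: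 2\arcsin|\kappa|\le\psi\le\pi\}$, which are symmetric to each other with respect to the real axis. (With the parametrization $z=e^{2i\varphi}$, $\varphi\in(-\pi/2,\pi/2]$, the absolutely continuous part is $\sqrt{1-\kappa^2/\sin^2\varphi}\;\mathbf 1_{\{|\sin\varphi|\ge|\kappa|\}}\,d\varphi/\pi$.) -/

import Mathlib

open MeasureTheory
open scoped ComplexOrder

noncomputable section

namespace FreeProb

/-- `τ` is a faithful tracial state on the unital C⋆-algebra `A`. -/
structure IsFaithfulTracialState {A : Type*} [CStarAlgebra A] (τ : A →ₗ[ℂ] ℂ) : Prop where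
  map_one : τ 1 = 1
  nonneg : ∀ a : A, 0 ≤ τ (star a * a)
  faithful : ∀ a : A, τ (star a * a) = 0 → a = 0
  tracial : ∀ a b : A, τ (a * b) = τ (b * a)

/-- Freeness of a family of unital ⋆-subalgebras: an alternating product of centred elements
(neighbouring factors taken from different subalgebras, at least one factor) is centred. -/
def IsFree {A : Type*} [CStarAlgebra A] (τ : A →ₗ[ℂ] ℂ) {ι : Type*}
    (B : ι → StarSubalgebra ℂ A) : Prop :=
  ∀ l : List (ι × A), l ≠ [] → l.IsChain (fun x y => x.1 ≠ y.1) →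
    (∀ x ∈ l, x.2 ∈ B x.1 ∧ τ x.2 = 0) → τ (l.map Prod.snd).prod = 0

/-- The elements `a` and `b` are ⋆-free: the unital ⋆-subalgebras they generate are free. -/
def IsStarFree {A : Type*} [CStarAlgebra A] (τ : A →ₗ[ℂ] ℂ) (a b : A) : Prop :=
  IsFree τ ![StarAlgebra.adjoin ℂ {a}, StarAlgebra.adjoin ℂ {b}]

/-- The unitary `u` is a Haar unitary: all its nontrivial integer powers are centred. -/
def IsHaarUnitary {A : Type*} [CStarAlgebra A] (τ : A →ₗ[ℂ] ℂ) (u : unitary A) : Prop :=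
  ∀ k : ℤ, k ≠ 0 → τ ((u ^ k : unitary A) : A) = 0

/-- The measure `μ` is the spectral distribution of the unitary `w` with respect to `τ`: a
probability measure on `ℂ` carried by the unit circle, with the same moments as `w`. (The moments
of negative order are the complex conjugates of these.) -/
structure IsSpectralDistribution {A : Type*} [CStarAlgebra A] (τ : A →ₗ[ℂ] ℂ) (w : A)
    (μ : Measure ℂ) : Prop where
  unitary : w ∈ unitary A
  isProbabilityMeasure : IsProbabilityMeasure μ
  circle : μ (Metric.sphere (0 : ℂ) 1)ᶜ = 0
  moments : ∀ n : ℕ, ∫ z, z ^ n ∂μ = τ (w ^ n)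

/-- Normalized Lebesgue measure `dψ / (2π)` on the angles `ψ ∈ (-π, π]`. -/
def angleMeasure : Measure ℝ :=
  ENNReal.ofReal (2 * Real.pi)⁻¹ • volume.restrict (Set.Ioc (-Real.pi) Real.pi)

/-- The normalized Haar measure of the unit circle, as a measure on `ℂ`. -/
def circleHaar : Measure ℂ :=
  angleMeasure.map fun ψ : ℝ => Complex.exp (ψ * Complex.I)

/-- The function `ψ ↦ √(1 - κ² / sin² (ψ/2)) · 1_{|sin (ψ/2)| ≥ |κ|}`. -/
def density (κ : ℝ) : ℝ → ℝ :=
  Set.indicator {ψ : ℝ | |κ| ≤ |Real.sin (ψ / 2)|}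
    fun ψ => Real.sqrt (1 - κ ^ 2 / Real.sin (ψ / 2) ^ 2)

/-- The measure `density κ ψ dψ / (2π)` on the unit circle, at the points `exp (i ψ)`. -/
def acPart (κ : ℝ) : Measure ℂ :=
  (angleMeasure.withDensity fun ψ => ENNReal.ofReal (density κ ψ)).map
    fun ψ : ℝ => Complex.exp (ψ * Complex.I)

/-- The atom of mass `|κ|` at the point `1`. -/
def atomPart (κ : ℝ) : Measure ℂ :=
  ENNReal.ofReal |κ| • Measure.dirac 1

/-- The two arcs `{exp (± i ψ) : 2 arcsin |κ| ≤ ψ ≤ π}`. -/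
def arcs (κ : ℝ) : Set ℂ :=
  {z | ∃ ψ ∈ Set.Icc (2 * Real.arcsin |κ|) Real.pi,
    z = Complex.exp (ψ * Complex.I) ∨ z = Complex.exp (-(ψ * Complex.I))}

end FreeProb

end

namespace FreeProb

open Polynomial Set

/-! Put `T = U S U⋆` and `Z = ST + TS`; as `ST` and `TS` are mutually inverse with equal moments,
the moments of `ST` are traces of polynomials in `Z`. Consider `x = (S - κ)(T - κ)` and `y = (T +
κ)(S + κ)`. Then `xy = yx = (1 - κ²)²` and `x + y = Z + 2κ²`, so the Dickson polynomials of
parameter `(1 - κ²)²` take the value `xⁿ + yⁿ` at `Z + 2κ²`.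

Freeness gives `τ(xⁿ) = 0` for `n ≥ 1`, and it enters nowhere else. The difference `τ(xⁿ - yⁿ)`
needs only traciality: `Z` commutes with `S` and `T`, and `τ(S q(Z)) = τ(T q(Z)) = κ q(2)`. This
yields `trace_aeval_dickson`. Dickson polynomials span `ℂ[X]`, so these values determine the trace
on all polynomials in `Z`.

The candidate measure has the same values (`modelFunctional_dickson`). The substitution `cos ψ = (1
- κ²) cos θ - κ²` turns its density into `1 - |κ| P_r(θ)`, with `P_r` the Poisson kernel at `r = (1
- |κ|)/(1 + |κ|)`, and turns the Dickson polynomials into `2 (1 - κ²)ⁿ cos nθ`. The Poisson term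
cancels half of the contribution of the atom. Finally, moments determine a finite measure on the
circle (`measure_ext_of_integral_pow`). -/

/-! ### Dickson polynomials -/

theorem aeval_add_dickson_one {A : Type*} [Ring A] [Algebra ℂ A] {x y : A} {a : ℂ}
    (hxy : x * y = algebraMap ℂ A a) (hyx : y * x = algebraMap ℂ A a) (n : ℕ) :
    aeval (x + y) (dickson 1 a n) = x ^ n + y ^ n := by
  induction n using Nat.twoStepInduction with
  | zero => simp only [dickson_zero, pow_zero, Nat.cast_one, map_sub, map_one, map_ofNat]; norm_num
  | one => simp
  | more n h0 h1 =>
    have e1 : y * x ^ (n + 1) = algebraMap ℂ A a * x ^ n := by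
      rw [pow_succ', ← mul_assoc, hyx]
    have e2 : x * y ^ (n + 1) = algebraMap ℂ A a * y ^ n := by
      rw [pow_succ', ← mul_assoc, hxy]
    simp only [dickson_add_two, map_sub, map_mul, aeval_X, aeval_C, h0, h1]
    rw [add_mul, mul_add, mul_add, e1, e2, mul_add, pow_succ' x (n + 1), pow_succ' y (n + 1)]
    abel

/-- The recurrence makes the span stable under multiplication by `X`, and it contains `1` because
the polynomial of index 0 is the constant 2. -/
theorem span_range_dickson_one (a : ℂ) :
    Submodule.span ℂ (Set.range fun n => dickson 1 a n) = ⊤ := by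
  set M := Submodule.span ℂ (Set.range fun n => dickson 1 a n) with hM
  have hd : ∀ n, dickson 1 a n ∈ M := fun n => Submodule.subset_span ⟨n, rfl⟩
  have hX : ∀ p ∈ M, X * p ∈ M := by
    intro p hp
    induction hp using Submodule.span_induction with
    | zero => simp
    | add p q _ _ hp hq => rw [mul_add]; exact M.add_mem hp hq
    | smul c p _ hp => rw [mul_smul_comm]; exact M.smul_mem c hp
    | mem p hp =>
      obtain ⟨n, rfl⟩ := hp
      cases n with
      | zero =>
        have : (X : ℂ[X]) * dickson 1 a 0 = (2 : ℂ) • dickson 1 a 1 := by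
          rw [dickson_zero, dickson_one, smul_eq_C_mul, C_ofNat]
          norm_num [mul_comm]
        simp only [this]
        exact M.smul_mem _ (hd 1)
      | succ n =>
        have : (X : ℂ[X]) * dickson 1 a (n + 1) = dickson 1 a (n + 2) + a • dickson 1 a n := by
          rw [dickson_add_two, smul_eq_C_mul]; ring
        simp only [this]
        exact M.add_mem (hd _) (M.smul_mem _ (hd _))
  have h1 : (1 : ℂ[X]) ∈ M := by
    have : (1 : ℂ[X]) = (2⁻¹ : ℂ) • dickson 1 a 0 := by
      rw [dickson_zero, Nat.cast_one, show (3 : ℂ[X]) - 1 = C 2 by rw [C_ofNat]; norm_num,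
        smul_C]
      norm_num
    rw [this]
    exact M.smul_mem _ (hd 0)
  have hpow : ∀ n : ℕ, (X : ℂ[X]) ^ n ∈ M := by
    intro n
    induction n with
    | zero => simpa using h1
    | succ n ih => rw [pow_succ']; exact hX _ ih
  rw [eq_top_iff]
  intro p _
  rw [p.as_sum_range_C_mul_X_pow]
  refine M.sum_mem fun i _ => ?_
  rw [← smul_eq_C_mul]
  exact M.smul_mem _ (hpow i)

theorem commute_aeval_right {A : Type*} [Ring A] [Algebra ℂ A] {x y : A} (h : Commute x y)
    (q : ℂ[X]) : Commute x (aeval y q) := by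
  rw [aeval_eq_sum_range]
  exact Commute.sum_right _ _ _ fun i _ => (h.pow_right i).smul_right _

/-! ### Traces in the algebra generated by two symmetries -/

section Dihedral

variable {A : Type*} [Ring A] [Algebra ℂ A] {τ : A →ₗ[ℂ] ℂ} {S T : A} {κ : ℂ}

theorem commute_mul_add_mul {A : Type*} [Ring A] {S : A} (hS : S * S = 1) (T : A) :
    Commute (S * T + T * S) S := by
  unfold Commute SemiconjBy
  have e : T * S * S = T := by rw [mul_assoc, hS, mul_one]
  have e' : S * (S * T) = T := by rw [← mul_assoc, hS, one_mul]
  rw [add_mul, mul_add, e, e', mul_assoc, add_comm]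

/-- For `p` commuting with `S`, `S Z p = T p + S T S p`, and both terms have trace `τ(T p)`. Each
factor `Z` thus exchanges `S` with `T` and doubles the trace, as if `Z` were 2. -/
theorem trace_mul_aeval (htr : ∀ a b, τ (a * b) = τ (b * a)) (hS : S * S = 1) (hT : T * T = 1)
    (hτS : τ S = κ) (hτT : τ T = κ) (q : ℂ[X]) :
    τ (S * aeval (S * T + T * S) q) = κ * q.eval 2 ∧
      τ (T * aeval (S * T + T * S) q) = κ * q.eval 2 := by
  set Z := S * T + T * S with hZ
  have key : ∀ {R R' : A} (_ : R * R = 1) (_ : R' * R' = 1) (p : A)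
      (_ : Commute R p), τ (R * ((R * R' + R' * R) * p)) = 2 * τ (R' * p) := by
    intro R R' h h' p hp
    have e1 : R * ((R * R' + R' * R) * p) = R' * p + R * (R' * (R * p)) := by
      rw [← mul_assoc, mul_add, ← mul_assoc, h, one_mul, add_mul]; simp only [mul_assoc]
    rw [e1, map_add, hp.eq, htr R]
    have : R' * (p * R) * R = R' * p := by simp only [mul_assoc, h, mul_one]
    rw [this]; ring
  have hpow : ∀ n : ℕ, τ (S * Z ^ n) = κ * 2 ^ n ∧ τ (T * Z ^ n) = κ * 2 ^ n := by
    intro n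
    induction n with
    | zero => simp [hτS, hτT]
    | succ n ih =>
      have c1 : Commute S (Z ^ n) := ((commute_mul_add_mul hS T).pow_left n).symm
      have c2 : Commute T ((T * S + S * T) ^ n) := ((commute_mul_add_mul hT S).pow_left n).symm
      constructor
      · rw [pow_succ', hZ, key hS hT _ c1, ih.2]; ring
      · rw [pow_succ', hZ, add_comm (S * T), key hT hS _ c2, add_comm (T * S), ← hZ, ih.1]; ring
  induction q using Polynomial.induction_on' with
  | add p q hp hq => simp only [map_add, mul_add, eval_add, hp, hq, and_self]
  | monomial n a =>
    simp only [aeval_monomial, eval_monomial, ← Algebra.smul_def, mul_smul_comm, map_smul, hpow,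
      smul_eq_mul]
    constructor <;> ring

/-- Both sides obey one second-order recurrence: at `Z = 2` the sum `x + y` becomes `2 + 2κ² = (1 +
κ)² + (1 - κ)²`, and `(1 + κ)²(1 - κ)² = (1 - κ²)²`. The factor `q` is kept general because the
induction absorbs `x + y` into it. -/
theorem trace_pow_sub_pow (htr : ∀ a b, τ (a * b) = τ (b * a)) (hS : S * S = 1) (hT : T * T = 1)
    (hτS : τ S = κ) (hτT : τ T = κ) {x y : A}
    (hx : x = (S - algebraMap ℂ A κ) * (T - algebraMap ℂ A κ))
    (hy : y = (T + algebraMap ℂ A κ) * (S + algebraMap ℂ A κ))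
    (hadd : x + y = S * T + T * S + algebraMap ℂ A (2 * κ ^ 2))
    (hxy : x * y = algebraMap ℂ A ((1 - κ ^ 2) ^ 2))
    (hyx : y * x = algebraMap ℂ A ((1 - κ ^ 2) ^ 2)) (n : ℕ) (q : ℂ[X]) :
    τ ((x ^ n - y ^ n) * aeval (S * T + T * S) q) =
      -κ * (((1 + κ) ^ 2) ^ n - ((1 - κ) ^ 2) ^ n) * q.eval 2 := by
  induction n using Nat.twoStepInduction generalizing q with
  | zero => simp
  | one =>
    have c1 : Commute S (aeval (S * T + T * S) q) :=
      commute_aeval_right (commute_mul_add_mul hS T).symm q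
    have e0 : x - y = S * T - T * S - (2 * κ) • S - (2 * κ) • T := by
      rw [hx, hy]
      simp only [sub_mul, mul_sub, add_mul, mul_add, ← Algebra.commutes κ, ← Algebra.smul_def]
      module
    have e1 : τ (S * T * aeval (S * T + T * S) q) = τ (T * S * aeval (S * T + T * S) q) := by
      rw [mul_assoc, htr, mul_assoc, ← c1.eq, ← mul_assoc]
    obtain ⟨h1, h2⟩ := trace_mul_aeval htr hS hT hτS hτT q
    simp only [pow_one, e0, sub_mul, map_sub, e1, smul_mul_assoc, map_smul, h1, h2, smul_eq_mul]
    ring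
  | more n h0 h1 =>
    have e : x ^ (n + 2) - y ^ (n + 2) = (x ^ (n + 1) - y ^ (n + 1)) * (x + y)
        - ((1 - κ ^ 2) ^ 2 : ℂ) • (x ^ n - y ^ n) := by
      have a1 : x ^ (n + 1) * y = ((1 - κ ^ 2) ^ 2 : ℂ) • x ^ n := by
        rw [pow_succ, mul_assoc, hxy, Algebra.smul_def, Algebra.commutes]
      have a2 : y ^ (n + 1) * x = ((1 - κ ^ 2) ^ 2 : ℂ) • y ^ n := by
        rw [pow_succ, mul_assoc, hyx, Algebra.smul_def, Algebra.commutes]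
      rw [sub_mul, mul_add, mul_add, a1, a2, ← pow_succ, ← pow_succ, smul_sub]
      abel
    have e2 : (x + y) * aeval (S * T + T * S) q =
        aeval (S * T + T * S) ((X + C (2 * κ ^ 2)) * q) := by
      rw [hadd]; simp
    rw [e, sub_mul, mul_assoc, e2, smul_mul_assoc, map_sub, map_smul, h0, h1]
    simp only [eval_mul, eval_add, eval_X, eval_C, smul_eq_mul]
    ring

/-- The trace of the Dickson polynomials in `ST + TS + 2κ²`, for two symmetries with freeness
entering only through the vanishing of the moments of `(S - κ)(T - κ)`. -/
theorem trace_aeval_dickson (htr : ∀ a b, τ (a * b) = τ (b * a)) (hone : τ 1 = 1)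
    (hS : S * S = 1) (hT : T * T = 1) (hτS : τ S = κ) (hτT : τ T = κ)
    (hfree : ∀ n : ℕ,
      τ (((S - algebraMap ℂ A κ) * (T - algebraMap ℂ A κ)) ^ (n + 1)) = 0) (n : ℕ) :
    τ (aeval (S * T + T * S + algebraMap ℂ A (2 * κ ^ 2)) (dickson 1 ((1 - κ ^ 2) ^ 2) n)) =
      if n = 0 then 2 else κ * (((1 + κ) ^ 2) ^ n - ((1 - κ) ^ 2) ^ n) := by
  obtain ⟨x, hx⟩ : ∃ x, x = (S - algebraMap ℂ A κ) * (T - algebraMap ℂ A κ) := ⟨_, rfl⟩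
  obtain ⟨y, hy⟩ : ∃ y, y = (T + algebraMap ℂ A κ) * (S + algebraMap ℂ A κ) := ⟨_, rfl⟩
  have hadd : x + y = S * T + T * S + algebraMap ℂ A (2 * κ ^ 2) := by
    rw [hx, hy]
    simp only [sub_mul, mul_sub, add_mul, mul_add, ← Algebra.commutes κ, map_mul, map_pow,
      map_ofNat]
    noncomm_ring
  have hdiff : ∀ R : A, R * R = 1 →
      (R - algebraMap ℂ A κ) * (R + algebraMap ℂ A κ) = algebraMap ℂ A (1 - κ ^ 2) ∧
      (R + algebraMap ℂ A κ) * (R - algebraMap ℂ A κ) = algebraMap ℂ A (1 - κ ^ 2) := by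
    intro R hR
    constructor <;>
    · simp only [sub_mul, mul_sub, add_mul, mul_add, ← Algebra.commutes κ, hR, map_sub, map_one,
        map_mul, pow_two]
      abel
  have hprod : ∀ {a b b' a' : A} {c : ℂ}, b * b' = algebraMap ℂ A c → a * a' = algebraMap ℂ A c →
      a * b * (b' * a') = algebraMap ℂ A (c ^ 2) := by
    intro a b b' a' c h h'
    rw [mul_assoc, ← mul_assoc b, h, Algebra.commutes, ← mul_assoc, h', ← map_mul, sq]
  have hxy : x * y = algebraMap ℂ A ((1 - κ ^ 2) ^ 2) := by
    rw [hx, hy]; exact hprod (hdiff T hT).1 (hdiff S hS).1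
  have hyx : y * x = algebraMap ℂ A ((1 - κ ^ 2) ^ 2) := by
    rw [hx, hy]; exact hprod (hdiff S hS).2 (hdiff T hT).2
  rw [← hadd, aeval_add_dickson_one hxy hyx]
  cases n with
  | zero => simp [hone]; norm_num
  | succ n =>
    have := trace_pow_sub_pow htr hS hT hτS hτT hx hy hadd hxy hyx (n + 1) 1
    have hf := hfree n
    rw [← hx] at hf
    simp only [map_one, mul_one, map_sub, eval_one, hf] at this
    rw [map_add, hf, if_neg (Nat.succ_ne_zero n)]
    linear_combination -this

end Dihedral

theorem trace_mul_pow_comm {A : Type*} [Ring A] [Algebra ℂ A] {τ : A →ₗ[ℂ] ℂ}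
    (htr : ∀ a b, τ (a * b) = τ (b * a)) {S : A} (hS : S * S = 1) (T : A) (n : ℕ) :
    τ ((T * S) ^ n) = τ ((S * T) ^ n) := by
  have h : SemiconjBy S (T * S) (S * T) := by
    unfold SemiconjBy; rw [mul_assoc]
  have h' := (h.pow_right n).eq
  calc τ ((T * S) ^ n) = τ (S * (S * (T * S) ^ n)) := by rw [← mul_assoc, hS, one_mul]
    _ = τ ((S * T) ^ n) := by rw [h', htr, mul_assoc, hS, mul_one]

/-- The moments of `ST` from a linear functional that agrees with the trace on the Dickson
polynomials in `ST + TS + 2κ²`. -/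
theorem two_mul_trace_mul_pow {A : Type*} [Ring A] [Algebra ℂ A] {τ : A →ₗ[ℂ] ℂ}
    (htr : ∀ a b, τ (a * b) = τ (b * a)) (hone : τ 1 = 1) {S T : A} {κ : ℂ}
    (hS : S * S = 1) (hT : T * T = 1) (hτS : τ S = κ) (hτT : τ T = κ)
    (hfree : ∀ n : ℕ,
      τ (((S - algebraMap ℂ A κ) * (T - algebraMap ℂ A κ)) ^ (n + 1)) = 0)
    (Λ : ℂ[X] →ₗ[ℂ] ℂ)
    (hΛ : ∀ n, Λ (dickson 1 ((1 - κ ^ 2) ^ 2) n) =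
      if n = 0 then 2 else κ * (((1 + κ) ^ 2) ^ n - ((1 - κ) ^ 2) ^ n)) (n : ℕ) :
    2 * τ ((S * T) ^ n) = Λ ((dickson 1 1 n).comp (X - C (2 * κ ^ 2))) := by
  -- Parameter `(1 - κ²)²` identifies the functional; parameter 1 then extracts the moments, since
  -- `ST` and `TS` are mutually inverse.
  have hext : τ ∘ₗ (aeval (S * T + T * S + algebraMap ℂ A (2 * κ ^ 2))).toLinearMap = Λ := by
    refine LinearMap.ext_on_range (span_range_dickson_one ((1 - κ ^ 2) ^ 2)) fun i => ?_
    rw [hΛ, ← trace_aeval_dickson htr hone hS hT hτS hτT hfree i]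
    rfl
  have h1 : S * T * (T * S) = algebraMap ℂ A 1 := by
    rw [mul_assoc, ← mul_assoc T, hT, one_mul, hS, map_one]
  have h2 : T * S * (S * T) = algebraMap ℂ A 1 := by
    rw [mul_assoc, ← mul_assoc S, hS, one_mul, hT, map_one]
  have e : aeval (S * T + T * S + algebraMap ℂ A (2 * κ ^ 2))
      ((dickson 1 1 n).comp (X - C (2 * κ ^ 2))) = (S * T) ^ n + (T * S) ^ n := by
    rw [← aeval_add_dickson_one h1 h2 n, aeval_comp]
    simp
  rw [← hext, LinearMap.comp_apply, AlgHom.toLinearMap_apply, e, map_add,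
    trace_mul_pow_comm htr hS T n]
  ring

/-! ### Consequences of positivity and freeness -/

section Operator

variable {A : Type*} [CStarAlgebra A] {τ : A →ₗ[ℂ] ℂ}

/-- Positivity of `τ` on the projections `P` and `1 - P`, with `τ P = (κ + 1)/2`. -/
theorem IsFaithfulTracialState.abs_trace_symmetry_le_one (hτ : IsFaithfulTracialState τ) {P : A}
    (hP : IsStarProjection P) {κ : ℝ} (hκ : τ (2 * P - 1) = (κ : ℂ)) : |κ| ≤ 1 := by
  have h1 := hτ.nonneg P
  have h2 := hτ.nonneg (1 - P)
  rw [hP.isSelfAdjoint.star_eq, hP.isIdempotentElem.eq] at h1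
  rw [hP.one_sub.isSelfAdjoint.star_eq, hP.one_sub.isIdempotentElem.eq, map_sub,
    hτ.map_one] at h2
  have h3 : τ P = ((κ + 1) / 2 : ℝ) := by
    have : (2 : A) * P = (2 : ℂ) • P := by rw [Algebra.smul_def, map_ofNat]
    rw [this, map_sub, map_smul, hτ.map_one, smul_eq_mul] at hκ
    push_cast
    linear_combination hκ / 2
  rw [h3] at h1 h2
  have h1' : (0 : ℝ) ≤ (κ + 1) / 2 := by exact_mod_cast h1
  have h2' : (0 : ℝ) ≤ 1 - (κ + 1) / 2 := by exact_mod_cast h2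
  rw [abs_le]
  constructor <;> linarith

/-- The power is an alternating word in the centred letters `s, U, s, U⋆`, to which freeness applies
directly. -/
theorem IsStarFree.trace_alternating_pow {P s : A} {U : unitary A} (hfree : IsStarFree τ P (U : A))
    (hU : IsHaarUnitary τ U) (hs : s ∈ StarAlgebra.adjoin ℂ {P}) (hτs : τ s = 0) (n : ℕ) :
    τ ((s * ((U : A) * s * star (U : A))) ^ (n + 1)) = 0 := by
  set B : List (Fin 2 × A) := [(0, s), (1, (U : A)), (0, s), (1, star (U : A))] with hB
  have hprod : ∀ n : ℕ, (((List.replicate n B).flatten).map Prod.snd).prod =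
      (s * ((U : A) * s * star (U : A))) ^ n := by
    intro n
    induction n with
    | zero => simp
    | succ n ih =>
      rw [List.replicate_succ, List.flatten_cons, List.map_append, List.prod_append, ih, pow_succ']
      simp [hB, mul_assoc]
  -- The extra head stands for the last letter of the preceding block, so that the induction also
  -- covers the junctions; `.tail` removes it afterwards.
  have hchain : ∀ n : ℕ, ((1, star (U : A)) :: (List.replicate n B).flatten).IsChain
      (fun x y : Fin 2 × A => x.1 ≠ y.1) := by
    intro n
    induction n with
    | zero => simp
    | succ n ih =>
      rw [List.replicate_succ, List.flatten_cons, hB]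
      simp only [List.cons_append, List.nil_append, List.isChain_cons_cons, ne_eq]
      exact ⟨by decide, by decide, by decide, by decide, ih⟩
  have hUmem : (U : A) ∈ StarAlgebra.adjoin ℂ {(U : A)} :=
    StarAlgebra.self_mem_adjoin_singleton ℂ _
  have hU1 : τ (U : A) = 0 := by simpa using hU 1 one_ne_zero
  have hU2 : τ (star (U : A)) = 0 := by
    have := hU (-1) (by norm_num)
    rwa [zpow_neg_one, ← Unitary.star_eq_inv, Unitary.coe_star] at this
  rw [← hprod (n + 1)]
  refine hfree _ ?_ ((hchain (n + 1)).tail) ?_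
  · rw [List.replicate_succ, List.flatten_cons, hB]; simp
  · intro x hx
    obtain ⟨l, hl, hxl⟩ := List.mem_flatten.1 hx
    rw [List.eq_of_mem_replicate hl, hB] at hxl
    simp only [List.mem_cons, List.not_mem_nil, or_false] at hxl
    rcases hxl with rfl | rfl | rfl | rfl
    · exact ⟨hs, hτs⟩
    · exact ⟨hUmem, hU1⟩
    · exact ⟨hs, hτs⟩
    · exact ⟨star_mem hUmem, hU2⟩

end Operator

/-! ### The density -/

theorem measurable_density (κ : ℝ) : Measurable (density κ) := by
  unfold density
  refine Measurable.indicator (by fun_prop) ?_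
  exact measurableSet_le measurable_const (by fun_prop)

theorem density_nonneg (κ ψ : ℝ) : 0 ≤ density κ ψ :=
  Set.indicator_nonneg (fun _ _ => Real.sqrt_nonneg _) _

theorem density_le_one (κ ψ : ℝ) : density κ ψ ≤ 1 := by
  refine Set.indicator_le' (fun x _ => ?_) (fun _ _ => zero_le_one) ψ
  have : 0 ≤ κ ^ 2 / Real.sin (x / 2) ^ 2 := by positivity
  exact Real.sqrt_le_one.2 (by linarith)

theorem density_neg (κ ψ : ℝ) : density κ (-ψ) = density κ ψ := by
  simp [density, Set.indicator_apply, neg_div]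

/-- A zero sine must be excluded: if also `κ = 0`, the convention `0 / 0 = 0` makes the density 1.
-/
theorem density_eq_zero {κ ψ : ℝ} (h0 : Real.sin (ψ / 2) ≠ 0) (h : |Real.sin (ψ / 2)| ≤ |κ|) :
    density κ ψ = 0 := by
  refine Set.indicator_apply_eq_zero.2 fun _ => Real.sqrt_eq_zero_of_nonpos ?_
  have h1 : Real.sin (ψ / 2) ^ 2 ≤ κ ^ 2 := sq_le_sq.2 h
  have h2 : 0 < Real.sin (ψ / 2) ^ 2 := by positivity
  rw [sub_nonpos, le_div_iff₀ h2]
  linarith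

theorem density_eq_zero_of_one_le {κ : ℝ} (hκ : 1 ≤ |κ|) (ψ : ℝ) : density κ ψ = 0 := by
  by_cases h : Real.sin (ψ / 2) = 0
  · refine Set.indicator_of_notMem ?_ _
    simp only [Set.mem_ofPred_eq, h, abs_zero, not_le]
    linarith
  · exact density_eq_zero h ((Real.abs_sin_le_one _).trans hκ)

theorem integrableOn_density_smul {κ : ℝ} {f : ℝ → ℂ} (hf : Continuous f) (a b : ℝ) :
    IntegrableOn (fun ψ => density κ ψ • f ψ) (Ioc a b) := by
  refine Integrable.mono hf.integrableOn_Ioc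
    ((measurable_density κ).aestronglyMeasurable.smul hf.aestronglyMeasurable) ?_
  refine ae_of_all _ fun ψ => ?_
  rw [norm_smul, Real.norm_of_nonneg (density_nonneg κ ψ)]
  exact mul_le_of_le_one_left (norm_nonneg _) (density_le_one κ ψ)

theorem setIntegral_density_smul_symm (κ : ℝ) {g : ℝ → ℂ} (hg : Continuous g) :
    ∫ ψ in Ioc (-Real.pi) Real.pi, density κ ψ • g (Real.cos ψ) =
      2 * ∫ ψ in Ioo 0 Real.pi, density κ ψ • g (Real.cos ψ) := by
  have hi : ∀ a b : ℝ, a ≤ b →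
      IntervalIntegrable (fun ψ => density κ ψ • g (Real.cos ψ)) volume a b := fun a b hab =>
    (intervalIntegrable_iff_integrableOn_Ioc_of_le hab).2
      (integrableOn_density_smul (hg.comp Real.continuous_cos) a b)
  have hpi := Real.pi_pos
  rw [← integral_Ioc_eq_integral_Ioo, ← intervalIntegral.integral_of_le (by linarith),
    ← intervalIntegral.integral_of_le hpi.le,
    ← intervalIntegral.integral_add_adjacent_intervals (hi (-Real.pi) 0 (by linarith))
      (hi 0 Real.pi hpi.le)]
  have : ∫ ψ in (-Real.pi)..0, density κ ψ • g (Real.cos ψ) =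
      ∫ ψ in 0..Real.pi, density κ ψ • g (Real.cos ψ) := by
    have h := intervalIntegral.integral_comp_neg (a := 0) (b := Real.pi)
      (fun ψ => density κ ψ • g (Real.cos ψ))
    simp only [density_neg, Real.cos_neg, neg_zero] at h
    exact h.symm
  rw [this]
  ring

/-! ### The substitution `cos ψ = (1 - κ²) cos θ - κ²` -/

section Substitution

variable {κ : ℝ}

theorem sin_half_sq (x : ℝ) : Real.sin (x / 2) ^ 2 = (1 - Real.cos x) / 2 := by
  rw [Real.sin_sq_eq_half_sub]
  ring_nf

theorem one_sub_sq_pos (hκ : |κ| < 1) : 0 < 1 - κ ^ 2 := by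
  have := (sq_lt_one_iff_abs_lt_one κ).2 hκ
  linarith

theorem cos_two_arcsin_abs (hκ : |κ| ≤ 1) :
    Real.cos (2 * Real.arcsin |κ|) = 1 - 2 * κ ^ 2 := by
  rw [Real.cos_two_mul, Real.cos_sq', Real.sin_arcsin (by linarith [abs_nonneg κ]) hκ, sq_abs]
  ring

theorem arcsin_abs_mem (κ : ℝ) : 2 * Real.arcsin |κ| ∈ Icc 0 Real.pi :=
  ⟨by linarith [Real.arcsin_nonneg.2 (abs_nonneg κ)],
    by linarith [Real.arcsin_le_pi_div_two |κ|]⟩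

/-- The affine map sends `(-1, 1)` onto `(-1, 1 - 2κ²)`, whose right end is the cosine of the edge
of the arc. -/
theorem image_arccos_arc (hκ : |κ| < 1) :
    (fun θ => Real.arccos ((1 - κ ^ 2) * Real.cos θ - κ ^ 2)) '' Ioo 0 Real.pi =
      Ioo (2 * Real.arcsin |κ|) Real.pi := by
  have hc := one_sub_sq_pos hκ
  obtain ⟨hk0, hk1⟩ := arcsin_abs_mem κ
  ext ψ
  constructor
  · rintro ⟨θ, ⟨h0, h1⟩, rfl⟩
    have c1 : Real.cos θ < 1 := by
      simpa using Real.cos_lt_cos_of_nonneg_of_le_pi le_rfl h1.le h0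
    have c2 : -1 < Real.cos θ := by
      simpa using Real.cos_lt_cos_of_nonneg_of_le_pi h0.le le_rfl h1
    have b1 : (1 - κ ^ 2) * Real.cos θ - κ ^ 2 < 1 - 2 * κ ^ 2 := by nlinarith
    have b2 : -1 < (1 - κ ^ 2) * Real.cos θ - κ ^ 2 := by nlinarith
    constructor
    · rw [← cos_two_arcsin_abs hκ.le] at b1
      by_contra! hle
      have := Real.cos_le_cos_of_nonneg_of_le_pi (Real.arccos_nonneg _) hk1 hle
      rw [Real.cos_arccos b2.le (b1.le.trans (Real.cos_le_one _))] at this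
      linarith
    · refine lt_of_le_of_ne (Real.arccos_le_pi _) fun h => ?_
      rw [Real.arccos_eq_pi] at h
      linarith
  · rintro ⟨h0, h1⟩
    have b1 : Real.cos ψ < 1 - 2 * κ ^ 2 := by
      rw [← cos_two_arcsin_abs hκ.le]
      exact Real.cos_lt_cos_of_nonneg_of_le_pi hk0 h1.le h0
    have b2 : -1 < Real.cos ψ := by
      simpa using Real.cos_lt_cos_of_nonneg_of_le_pi (hk0.trans h0.le) le_rfl h1
    have d1 : (Real.cos ψ + κ ^ 2) / (1 - κ ^ 2) < 1 := by rw [div_lt_one hc]; linarith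
    have d2 : -1 < (Real.cos ψ + κ ^ 2) / (1 - κ ^ 2) := by rw [lt_div_iff₀ hc]; linarith
    refine ⟨Real.arccos ((Real.cos ψ + κ ^ 2) / (1 - κ ^ 2)), ⟨Real.arccos_pos.2 d1, ?_⟩, ?_⟩
    · refine lt_of_le_of_ne (Real.arccos_le_pi _) fun h => ?_
      rw [Real.arccos_eq_pi] at h
      linarith
    · simp only
      rw [Real.cos_arccos d2.le d1.le, mul_div_cancel₀ _ hc.ne', add_sub_cancel_right,
        Real.arccos_cos (hk0.trans h0.le) h1.le]

/-- With `D = 1 - cos ψ`, the squared density is `(1 - κ²)(1 - cos θ)/D` and `sin² ψ = D (1 - κ²)(1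
+ cos θ)`, so the square roots combine into a rational function of `cos θ`. -/
theorem density_mul_deriv (hκ : |κ| < 1) {θ : ℝ} (hθ : θ ∈ Ioo 0 Real.pi) :
    |(1 - κ ^ 2) * Real.sin θ / √(1 - ((1 - κ ^ 2) * Real.cos θ - κ ^ 2) ^ 2)| *
        density κ (Real.arccos ((1 - κ ^ 2) * Real.cos θ - κ ^ 2)) =
      1 - 2 * κ ^ 2 / (1 + κ ^ 2 - (1 - κ ^ 2) * Real.cos θ) := by
  have hc := one_sub_sq_pos hκ
  obtain ⟨h0, h1⟩ := hθ
  have c1 : Real.cos θ < 1 := by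
    simpa using Real.cos_lt_cos_of_nonneg_of_le_pi le_rfl h1.le h0
  have c2 : -1 < Real.cos θ := by
    simpa using Real.cos_lt_cos_of_nonneg_of_le_pi h0.le le_rfl h1
  have hs := Real.sin_pos_of_pos_of_lt_pi h0 h1
  have hs2 := Real.sin_sq_add_cos_sq θ
  have hD : 0 < 1 + κ ^ 2 - (1 - κ ^ 2) * Real.cos θ := by nlinarith [sq_nonneg κ]
  have b1 : (1 - κ ^ 2) * Real.cos θ - κ ^ 2 ≤ 1 := by nlinarith
  have b2 : -1 ≤ (1 - κ ^ 2) * Real.cos θ - κ ^ 2 := by nlinarith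
  have hsin : Real.sin (Real.arccos ((1 - κ ^ 2) * Real.cos θ - κ ^ 2) / 2) ^ 2 =
      (1 + κ ^ 2 - (1 - κ ^ 2) * Real.cos θ) / 2 := by
    rw [sin_half_sq, Real.cos_arccos b2 b1]; ring
  have hmem : |κ| ≤ |Real.sin (Real.arccos ((1 - κ ^ 2) * Real.cos θ - κ ^ 2) / 2)| := by
    rw [← sq_le_sq, hsin]; nlinarith
  rw [density, Set.indicator_of_mem (by exact hmem), hsin]
  generalize Real.cos θ = x at *
  generalize Real.sin θ = y at *
  have e1 : 1 - ((1 - κ ^ 2) * x - κ ^ 2) ^ 2 =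
      (1 + κ ^ 2 - (1 - κ ^ 2) * x) * ((1 - κ ^ 2) * (1 + x)) := by ring
  have e2 : 1 - κ ^ 2 / ((1 + κ ^ 2 - (1 - κ ^ 2) * x) / 2) =
      (1 - κ ^ 2) * (1 - x) / (1 + κ ^ 2 - (1 - κ ^ 2) * x) := by
    field_simp; ring
  have e3 : 1 - 2 * κ ^ 2 / (1 + κ ^ 2 - (1 - κ ^ 2) * x) =
      (1 - κ ^ 2) * (1 - x) / (1 + κ ^ 2 - (1 - κ ^ 2) * x) := by
    field_simp; ring
  rw [e1, e2, e3]
  generalize hDD : 1 + κ ^ 2 - (1 - κ ^ 2) * x = D at *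
  have p1 : 0 < D * ((1 - κ ^ 2) * (1 + x)) := by
    have : 0 < 1 + x := by linarith
    positivity
  have p2 : 0 ≤ (1 - κ ^ 2) * (1 - x) / D := by
    have : 0 < 1 - x := by linarith
    positivity
  rw [abs_of_nonneg (by positivity)]
  -- Both sides are nonnegative, so it suffices to compare squares.
  refine (pow_left_inj₀ (by positivity) p2 two_ne_zero).1 ?_
  rw [mul_pow, div_pow, Real.sq_sqrt p1.le, Real.sq_sqrt p2, mul_pow,
    show y ^ 2 = (1 - x) * (1 + x) by linear_combination hs2]
  have : 1 + x ≠ 0 := by linarith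
  field_simp

theorem setIntegral_density_smul_eq (hκ : |κ| < 1) (g : ℝ → ℂ) :
    ∫ ψ in Ioo 0 Real.pi, density κ ψ • g (Real.cos ψ) =
      ∫ θ in Ioo 0 Real.pi, (1 - 2 * κ ^ 2 / (1 + κ ^ 2 - (1 - κ ^ 2) * Real.cos θ)) •
        g ((1 - κ ^ 2) * Real.cos θ - κ ^ 2) := by
  have hc := one_sub_sq_pos hκ
  obtain ⟨hk0, hk1⟩ := arcsin_abs_mem κ
  have hbd : ∀ θ ∈ Ioo 0 Real.pi, -1 < (1 - κ ^ 2) * Real.cos θ - κ ^ 2 ∧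
      (1 - κ ^ 2) * Real.cos θ - κ ^ 2 < 1 := by
    rintro θ ⟨h0, h1⟩
    have c1 : Real.cos θ < 1 := by
      simpa using Real.cos_lt_cos_of_nonneg_of_le_pi le_rfl h1.le h0
    have c2 : -1 < Real.cos θ := by
      simpa using Real.cos_lt_cos_of_nonneg_of_le_pi h0.le le_rfl h1
    constructor <;> nlinarith
  -- The density vanishes off the arc, so the domain shrinks to the image of the substitution.
  rw [setIntegral_eq_of_subset_of_forall_sdiff_eq_zero measurableSet_Ioo
    (Ioo_subset_Ioo_left hk0 : Ioo (2 * Real.arcsin |κ|) Real.pi ⊆ Ioo 0 Real.pi),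
    ← image_arccos_arc hκ,
    integral_image_eq_integral_abs_deriv_smul (f' := fun θ =>
      (1 - κ ^ 2) * Real.sin θ / √(1 - ((1 - κ ^ 2) * Real.cos θ - κ ^ 2) ^ 2)) measurableSet_Ioo]
  · refine setIntegral_congr_fun measurableSet_Ioo fun θ hθ => ?_
    rw [smul_smul, density_mul_deriv hκ hθ,
      Real.cos_arccos (hbd θ hθ).1.le (hbd θ hθ).2.le]
  · intro θ hθ
    have h1 : HasDerivAt (fun θ => (1 - κ ^ 2) * Real.cos θ - κ ^ 2)
        ((1 - κ ^ 2) * -Real.sin θ) θ := ((Real.hasDerivAt_cos θ).const_mul _).sub_const _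
    have h2 := (Real.hasDerivAt_arccos (hbd θ hθ).1.ne' (hbd θ hθ).2.ne).comp θ h1
    refine (h2.congr_deriv ?_).hasDerivWithinAt
    ring
  · intro θ hθ θ' hθ' h
    have h' := Real.arccos_injOn ⟨(hbd θ hθ).1.le, (hbd θ hθ).2.le⟩
      ⟨(hbd θ' hθ').1.le, (hbd θ' hθ').2.le⟩ h
    refine Real.injOn_cos ⟨hθ.1.le, hθ.2.le⟩ ⟨hθ'.1.le, hθ'.2.le⟩ ?_
    exact mul_left_cancel₀ hc.ne' (sub_left_injective h')
  · rintro ψ ⟨⟨h0, h1⟩, hψ⟩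
    have hle : ψ ≤ 2 * Real.arcsin |κ| := by
      by_contra! h
      exact hψ ⟨h, h1⟩
    have hs : 0 < Real.sin (ψ / 2) :=
      Real.sin_pos_of_pos_of_lt_pi (by linarith) (by linarith)
    rw [density_eq_zero hs.ne', zero_smul]
    rw [abs_of_pos hs, ← Real.sin_arcsin (by linarith [abs_nonneg κ]) hκ.le]
    exact Real.sin_le_sin_of_le_of_le_pi_div_two (by linarith)
      (Real.arcsin_le_pi_div_two _) (by linarith)

end Substitution

/-! ### Poisson kernel and Dickson integrals -/

theorem eval_add_dickson_one {x y a : ℂ} (h : x * y = a) (n : ℕ) :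
    (dickson 1 a n).eval (x + y) = x ^ n + y ^ n :=
  aeval_add_dickson_one h (by rw [mul_comm, h]; rfl) n

theorem integral_poissonKernel_exp_pow {r : ℝ} (h0 : 0 ≤ r) (h1 : r < 1) (n : ℕ) :
    ∫ θ in 0..2 * Real.pi, ((1 - r ^ 2) / (1 - 2 * r * Real.cos θ + r ^ 2)) •
      Complex.exp (θ * Complex.I) ^ n = 2 * Real.pi * (r : ℂ) ^ n := by
  have hf : DiffContOnCl ℂ (fun z : ℂ => z ^ n) (Metric.ball 0 1) :=
    (differentiable_pow n).diffContOnCl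
  have hw : (r : ℂ) ∈ Metric.ball (0 : ℂ) 1 := by simp [abs_of_nonneg h0, h1]
  have h := hf.circleAverage_poissonKernel_smul' hw
  rw [Real.circleAverage_def, inv_smul_eq_iff₀ (by positivity)] at h
  have e : ∀ θ : ℝ, ‖Complex.exp (θ * Complex.I) - r‖ ^ 2 = 1 - 2 * r * Real.cos θ + r ^ 2 := by
    intro θ
    rw [← Complex.normSq_eq_norm_sq, Complex.normSq_apply]
    simp only [Complex.sub_re, Complex.sub_im, Complex.exp_ofReal_mul_I_re,
      Complex.exp_ofReal_mul_I_im, Complex.ofReal_re, Complex.ofReal_im]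
    linear_combination Real.sin_sq_add_cos_sq θ
  simp only [circleMap, Complex.ofReal_one, one_mul, zero_add, sub_zero, e,
    Complex.norm_exp_ofReal_mul_I, Complex.norm_real, Real.norm_eq_abs, sq_abs, one_pow] at h
  rw [h, Complex.real_smul]
  push_cast
  ring

theorem kernel_denominator_pos {κ : ℝ} (hκ : |κ| ≤ 1) (h0 : κ ≠ 0) (θ : ℝ) :
    0 < 1 + κ ^ 2 - (1 - κ ^ 2) * Real.cos θ := by
  have h1 : κ ^ 2 ≤ 1 := (sq_le_one_iff_abs_le_one κ).2 hκ
  have h2 : 0 < κ ^ 2 := by positivity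
  nlinarith [Real.cos_le_one θ]

theorem continuous_kernel {κ : ℝ} (hκ : |κ| ≤ 1) :
    Continuous fun θ => 1 - 2 * κ ^ 2 / (1 + κ ^ 2 - (1 - κ ^ 2) * Real.cos θ) := by
  by_cases h0 : κ = 0
  · simp [h0, continuous_const]
  · exact continuous_const.sub
      (continuous_const.div (by fun_prop) fun θ => (kernel_denominator_pos hκ h0 θ).ne')

/-- The kernel is `1 - |κ| P_r` with `r = (1 - |κ|)/(1 + |κ|)`, and `P_r` integrates `zⁿ` to `2π
rⁿ`. -/
theorem integral_kernel_exp_pow {κ : ℝ} (hκ : |κ| ≤ 1) (n : ℕ) :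
    ∫ θ in 0..2 * Real.pi, (1 - 2 * κ ^ 2 / (1 + κ ^ 2 - (1 - κ ^ 2) * Real.cos θ)) •
      Complex.exp (θ * Complex.I) ^ n =
        2 * Real.pi * ((if n = 0 then 1 else 0) - |κ| * (((1 - |κ|) / (1 + |κ|) : ℝ) : ℂ) ^ n) := by
  have hone : ∫ θ in 0..2 * Real.pi, Complex.exp (θ * Complex.I) ^ n =
      2 * Real.pi * (if n = 0 then 1 else 0) := by
    simpa [zero_pow_eq] using integral_poissonKernel_exp_pow le_rfl zero_lt_one n
  -- Here `r` would be 1, outside the Poisson range, but the kernel is the constant 1.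
  by_cases h0 : κ = 0
  · simpa [h0] using hone
  have hk : 0 < |κ| := abs_pos.2 h0
  have hr0 : 0 ≤ (1 - |κ|) / (1 + |κ|) := div_nonneg (by linarith) (by linarith)
  have hr1 : (1 - |κ|) / (1 + |κ|) < 1 := by rw [div_lt_one (by linarith)]; linarith
  have hker : ∀ θ : ℝ, 1 - 2 * κ ^ 2 / (1 + κ ^ 2 - (1 - κ ^ 2) * Real.cos θ) =
      1 - |κ| * ((1 - ((1 - |κ|) / (1 + |κ|)) ^ 2) /
        (1 - 2 * ((1 - |κ|) / (1 + |κ|)) * Real.cos θ + ((1 - |κ|) / (1 + |κ|)) ^ 2)) := by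
    intro θ
    have hD := kernel_denominator_pos hκ h0 θ
    rw [← sq_abs κ] at hD ⊢
    generalize |κ| = k at *
    generalize Real.cos θ = x at *
    have hk1 : 1 + k ≠ 0 := by linarith
    have e : 1 - 2 * ((1 - k) / (1 + k)) * x + ((1 - k) / (1 + k)) ^ 2 =
        2 * (1 + k ^ 2 - (1 - k ^ 2) * x) / (1 + k) ^ 2 := by
      field_simp; ring
    have e' : 1 - ((1 - k) / (1 + k)) ^ 2 = 4 * k / (1 + k) ^ 2 := by
      field_simp; ring
    rw [e, e', div_div_div_cancel_right₀ (by positivity)]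
    field_simp
    ring
  have hcont : Continuous fun θ : ℝ => (1 - ((1 - |κ|) / (1 + |κ|)) ^ 2) /
        (1 - 2 * ((1 - |κ|) / (1 + |κ|)) * Real.cos θ + ((1 - |κ|) / (1 + |κ|)) ^ 2) := by
    refine continuous_const.div (by fun_prop) fun θ => ne_of_gt ?_
    generalize (1 - |κ|) / (1 + |κ|) = r at *
    nlinarith [Real.cos_le_one θ, sq_pos_of_pos (sub_pos.2 hr1)]
  simp_rw [hker, sub_smul, one_smul, mul_smul]
  rw [intervalIntegral.integral_sub, hone, intervalIntegral.integral_smul,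
    integral_poissonKernel_exp_pow hr0 hr1, Complex.real_smul]
  · ring
  · exact Continuous.intervalIntegrable (by fun_prop) _ _
  · refine Continuous.intervalIntegrable ?_ _ _
    exact continuous_const.smul (hcont.smul (by fun_prop))

theorem integral_symmetric_exp_pow {h : ℝ → ℝ} (hc : Continuous h)
    (hsymm : ∀ θ, h (2 * Real.pi - θ) = h θ) (n : ℕ) :
    ∫ θ in 0..Real.pi, h θ • (Complex.exp (θ * Complex.I) ^ n + Complex.exp (-(θ * Complex.I)) ^ n) =
      ∫ θ in 0..2 * Real.pi, h θ • Complex.exp (θ * Complex.I) ^ n := by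
  have hi1 : ∀ a b : ℝ, IntervalIntegrable (fun θ : ℝ => h θ • Complex.exp (θ * Complex.I) ^ n)
      volume a b := fun a b => Continuous.intervalIntegrable (by fun_prop) _ _
  have hi2 : ∀ a b : ℝ, IntervalIntegrable (fun θ : ℝ => h θ • Complex.exp (-(θ * Complex.I)) ^ n)
      volume a b := fun a b => Continuous.intervalIntegrable (by fun_prop) _ _
  simp_rw [smul_add]
  rw [intervalIntegral.integral_add (hi1 _ _) (hi2 _ _),
    ← intervalIntegral.integral_add_adjacent_intervals (hi1 0 Real.pi) (hi1 Real.pi (2 * Real.pi))]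
  congr 1
  have := intervalIntegral.integral_comp_sub_left (a := 0) (b := Real.pi)
    (fun θ : ℝ => h θ • Complex.exp (θ * Complex.I) ^ n) (2 * Real.pi)
  rw [sub_zero, show 2 * Real.pi - Real.pi = Real.pi by ring] at this
  rw [← this]
  refine intervalIntegral.integral_congr fun θ _ => ?_
  simp only [hsymm]
  congr 2
  rw [Complex.ofReal_sub, sub_mul, Complex.exp_sub, Complex.exp_neg]
  push_cast
  rw [Complex.exp_two_pi_mul_I, one_div]

theorem setIntegral_density_smul_dickson {κ : ℝ} (hκ : |κ| ≤ 1) (n : ℕ) :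
    ∫ ψ in Ioc (-Real.pi) Real.pi, density κ ψ •
      (dickson 1 ((1 - (κ : ℂ) ^ 2) ^ 2) n).eval (2 * (Real.cos ψ : ℂ) + 2 * (κ : ℂ) ^ 2) =
    4 * Real.pi * ((if n = 0 then 1 else 0) - |κ| * (((1 - |κ|) / (1 + |κ|) : ℝ) : ℂ) ^ n) *
      (1 - (κ : ℂ) ^ 2) ^ n := by
  -- At `|κ| = 1` the substitution degenerates, but both sides are zero.
  rcases hκ.eq_or_lt with h1 | h1
  · have hκ2 : (κ : ℂ) ^ 2 = 1 := by
      rw [← Complex.ofReal_pow, ← sq_abs, h1]; simp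
    simp only [density_eq_zero_of_one_le h1.ge, zero_smul, integral_zero, hκ2, h1]
    cases n <;> simp
  -- The argument is `2 (1 - κ²) cos θ`, the sum of `(1 - κ²) exp (± i θ)`, whose product is the
  -- Dickson parameter.
  have hdick : ∀ θ : ℝ, (dickson 1 ((1 - (κ : ℂ) ^ 2) ^ 2) n).eval
      (2 * (((1 - κ ^ 2) * Real.cos θ - κ ^ 2 : ℝ) : ℂ) + 2 * (κ : ℂ) ^ 2) =
      (1 - (κ : ℂ) ^ 2) ^ n *
        (Complex.exp (θ * Complex.I) ^ n + Complex.exp (-(θ * Complex.I)) ^ n) := by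
    intro θ
    have hee : Complex.exp (θ * Complex.I) * Complex.exp (-(θ * Complex.I)) = 1 := by
      rw [← Complex.exp_add, add_neg_cancel, Complex.exp_zero]
    have hprod : (1 - (κ : ℂ) ^ 2) * Complex.exp (θ * Complex.I) *
        ((1 - (κ : ℂ) ^ 2) * Complex.exp (-(θ * Complex.I))) = (1 - (κ : ℂ) ^ 2) ^ 2 := by
      linear_combination (1 - (κ : ℂ) ^ 2) ^ 2 * hee
    have := eval_add_dickson_one hprod n
    rw [mul_pow, mul_pow, ← mul_add (_ ^ n), ← mul_add] at this
    rw [← this]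
    congr 1
    push_cast
    rw [Complex.cos, neg_mul]
    ring
  rw [setIntegral_density_smul_symm κ (g := fun x =>
      (dickson 1 ((1 - (κ : ℂ) ^ 2) ^ 2) n).eval (2 * (x : ℂ) + 2 * (κ : ℂ) ^ 2)) (by fun_prop),
    setIntegral_density_smul_eq h1 (fun x =>
      (dickson 1 ((1 - (κ : ℂ) ^ 2) ^ 2) n).eval (2 * (x : ℂ) + 2 * (κ : ℂ) ^ 2))]
  simp_rw [hdick, ← mul_smul_comm]
  rw [← integral_Ioc_eq_integral_Ioo, ← intervalIntegral.integral_of_le Real.pi_pos.le,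
    intervalIntegral.integral_const_mul,
    integral_symmetric_exp_pow (continuous_kernel hκ) (fun θ => by rw [Real.cos_two_pi_sub]),
    integral_kernel_exp_pow hκ]
  ring

/-! ### The functional of the model measure -/

/-- Integration of `q(2 Re z + 2κ²)` against `atomPart κ + acPart κ`, as a functional of `q`. -/
noncomputable def modelFunctional (κ : ℝ) : ℂ[X] →ₗ[ℂ] ℂ where
  toFun q := |κ| * q.eval (2 + 2 * (κ : ℂ) ^ 2) + (2 * Real.pi : ℂ)⁻¹ *
    ∫ ψ in Ioc (-Real.pi) Real.pi,
      density κ ψ • q.eval (2 * (Real.cos ψ : ℂ) + 2 * (κ : ℂ) ^ 2)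
  map_add' p q := by
    simp only [eval_add, smul_add]
    rw [integral_add (integrableOn_density_smul (by fun_prop) _ _)
      (integrableOn_density_smul (by fun_prop) _ _)]
    ring
  map_smul' a q := by
    simp only [eval_smul, smul_eq_mul, RingHom.id_apply, ← mul_smul_comm]
    rw [integral_const_mul]
    ring

/-- The atom gives `|κ| ((1 + κ)²ⁿ + (1 - κ)²ⁿ)`. As `r (1 - κ²) = (1 - |κ|)²`, the other part
subtracts `2|κ| (1 - |κ|)²ⁿ` (and adds 2 if `n = 0`). The result is even in `κ`, which removes the
absolute values. -/
theorem modelFunctional_dickson {κ : ℝ} (hκ : |κ| ≤ 1) (n : ℕ) :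
    modelFunctional κ (dickson 1 ((1 - (κ : ℂ) ^ 2) ^ 2) n) =
      if n = 0 then 2 else (κ : ℂ) * (((1 + (κ : ℂ)) ^ 2) ^ n - ((1 - (κ : ℂ)) ^ 2) ^ n) := by
  have hprod : (1 + (κ : ℂ)) ^ 2 * (1 - (κ : ℂ)) ^ 2 = (1 - (κ : ℂ) ^ 2) ^ 2 := by ring
  have hev := eval_add_dickson_one hprod n
  rw [show (1 + (κ : ℂ)) ^ 2 + (1 - (κ : ℂ)) ^ 2 = 2 + 2 * (κ : ℂ) ^ 2 by ring] at hev
  have hpi : (Real.pi : ℂ) ≠ 0 := by exact_mod_cast Real.pi_ne_zero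
  simp only [modelFunctional, LinearMap.coe_mk, AddHom.coe_mk]
  rw [hev, setIntegral_density_smul_dickson hκ]
  have hrc : (((1 - |κ|) / (1 + |κ|) : ℝ) : ℂ) ^ n * (1 - (κ : ℂ) ^ 2) ^ n =
      ((1 - (|κ| : ℝ) : ℂ) ^ 2) ^ n := by
    rw [← mul_pow]
    congr 1
    have h : (1 - |κ|) / (1 + |κ|) * (1 - κ ^ 2) = (1 - |κ|) ^ 2 := by
      rw [← sq_abs κ]
      have : 1 + |κ| ≠ 0 := by positivity
      field_simp
      ring
    exact_mod_cast h
  have hmain : ∀ w : ℂ, (2 * Real.pi : ℂ)⁻¹ * (4 * Real.pi * w) = 2 * w := by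
    intro w; field_simp; ring
  rw [mul_assoc (4 * (Real.pi : ℂ)), hmain, sub_mul, mul_assoc, hrc]
  split_ifs with hn
  · subst hn; simp; ring
  · rcases abs_choice κ with h | h <;> rw [h] <;> push_cast <;> ring

/-! ### Lebesgue decomposition, support and moments of the model measure -/

theorem measurable_expAngle : Measurable fun ψ : ℝ => Complex.exp (ψ * Complex.I) := by fun_prop

instance isFiniteMeasure_angleMeasure : IsFiniteMeasure angleMeasure :=
  Measure.smul_finite _ ENNReal.ofReal_ne_top

instance isFiniteMeasure_acPart (κ : ℝ) : IsFiniteMeasure (acPart κ) := by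
  have : IsFiniteMeasure (angleMeasure.withDensity fun ψ => ENNReal.ofReal (density κ ψ)) := by
    refine isFiniteMeasure_withDensity (ne_of_lt ?_)
    calc ∫⁻ ψ, ENNReal.ofReal (density κ ψ) ∂angleMeasure
        ≤ ∫⁻ _, 1 ∂angleMeasure := lintegral_mono fun ψ => by
          simpa using ENNReal.ofReal_le_ofReal (density_le_one κ ψ)
      _ < ⊤ := by simp [measure_lt_top]
  unfold acPart
  infer_instance

instance isFiniteMeasure_atomPart (κ : ℝ) : IsFiniteMeasure (atomPart κ) :=
  Measure.smul_finite _ ENNReal.ofReal_ne_top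

theorem acPart_absolutelyContinuous (κ : ℝ) : acPart κ ≪ circleHaar :=
  (withDensity_absolutelyContinuous _ _).map measurable_expAngle

theorem circleHaar_singleton_one : circleHaar {1} = 0 := by
  rw [circleHaar, Measure.map_apply measurable_expAngle (measurableSet_singleton 1), angleMeasure,
    Measure.smul_apply,
    Measure.restrict_apply (measurable_expAngle (measurableSet_singleton 1))]
  have hsub : (fun ψ : ℝ => Complex.exp (ψ * Complex.I)) ⁻¹' {1} ∩ Ioc (-Real.pi) Real.pi ⊆ {0} := by
    rintro ψ ⟨hψ, h1, h2⟩
    have h : Complex.exp (ψ * Complex.I) = 1 := hψ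
    have hcos : Real.cos ψ = 1 := by
      have := congrArg Complex.re h
      simpa [Complex.exp_ofReal_mul_I_re] using this
    have hpi := Real.pi_pos
    exact (Real.cos_eq_one_iff_of_lt_of_lt (by linarith) (by linarith)).1 hcos
  rw [measure_mono_null hsub (by simp), smul_zero]

theorem atomPart_mutuallySingular (κ : ℝ) : atomPart κ ⟂ₘ circleHaar := by
  refine ⟨{1}ᶜ, (measurableSet_singleton 1).compl, ?_, ?_⟩
  · simp [atomPart]
  · rw [compl_compl, circleHaar_singleton_one]

theorem measurableSet_arcs (κ : ℝ) : MeasurableSet (arcs κ) := by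
  have h : arcs κ = (fun ψ : ℝ => Complex.exp (ψ * Complex.I)) '' Icc (2 * Real.arcsin |κ|) Real.pi ∪
      (fun ψ : ℝ => Complex.exp (-(ψ * Complex.I))) '' Icc (2 * Real.arcsin |κ|) Real.pi := by
    ext z
    simp only [arcs, mem_ofPred_eq, mem_union, mem_image, ← exists_or, ← and_or_left, eq_comm]
  rw [h]
  exact ((isCompact_Icc.image (by fun_prop)).union
    (isCompact_Icc.image (by fun_prop))).isClosed.measurableSet

theorem density_eq_zero_of_notMem_arcs {κ ψ : ℝ} (hκ : |κ| ≤ 1)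
    (hψ : ψ ∈ Ioc (-Real.pi) Real.pi) (h : Complex.exp (ψ * Complex.I) ∉ arcs κ) :
    density κ ψ = 0 := by
  have habs : |ψ| ≤ Real.pi := abs_le.2 ⟨hψ.1.le, hψ.2⟩
  have hlt : |ψ| < 2 * Real.arcsin |κ| := by
    by_contra! hle
    refine h ⟨|ψ|, ⟨hle, habs⟩, ?_⟩
    rcases abs_choice ψ with h' | h' <;> rw [h']
    · exact Or.inl rfl
    · right; push_cast; ring_nf
  refine Set.indicator_of_notMem ?_ _
  have hsin : |Real.sin (ψ / 2)| = Real.sin (|ψ| / 2) := by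
    have h0 : 0 ≤ Real.sin (|ψ| / 2) :=
      Real.sin_nonneg_of_nonneg_of_le_pi (by positivity) (by linarith [Real.pi_pos])
    rw [← abs_of_nonneg h0]
    rcases abs_choice ψ with h' | h' <;> simp [h', neg_div]
  rw [mem_ofPred_eq, not_le, hsin, ← Real.sin_arcsin (by linarith [abs_nonneg κ]) hκ]
  exact Real.sin_lt_sin_of_lt_of_le_pi_div_two
    (by linarith [abs_nonneg ψ, Real.pi_pos]) (Real.arcsin_le_pi_div_two _) (by linarith)

theorem acPart_compl_arcs {κ : ℝ} (hκ : |κ| ≤ 1) : acPart κ (arcs κ)ᶜ = 0 := by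
  have hm := measurable_expAngle (measurableSet_arcs κ).compl
  rw [acPart, Measure.map_apply measurable_expAngle (measurableSet_arcs κ).compl,
    withDensity_apply _ hm, lintegral_eq_zero_iff (measurable_density κ).ennreal_ofReal]
  have hae : ∀ᵐ ψ ∂angleMeasure, ψ ∈ Ioc (-Real.pi) Real.pi :=
    Measure.ae_smul_measure (ae_restrict_mem measurableSet_Ioc) _
  filter_upwards [ae_restrict_mem hm, ae_restrict_of_ae hae] with ψ h1 h2
  simp [density_eq_zero_of_notMem_arcs hκ h2 h1]

theorem acPart_compl_sphere (κ : ℝ) : acPart κ (Metric.sphere (0 : ℂ) 1)ᶜ = 0 := by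
  rw [acPart, Measure.map_apply measurable_expAngle Metric.isClosed_sphere.measurableSet.compl]
  have : (fun ψ : ℝ => Complex.exp (ψ * Complex.I)) ⁻¹' (Metric.sphere (0 : ℂ) 1)ᶜ = ∅ := by
    ext ψ; simp [Complex.norm_exp_ofReal_mul_I]
  rw [this, measure_empty]

theorem atomPart_compl_sphere (κ : ℝ) : atomPart κ (Metric.sphere (0 : ℂ) 1)ᶜ = 0 := by
  rw [atomPart, Measure.smul_apply, Measure.dirac_apply' _
    Metric.isClosed_sphere.measurableSet.compl]
  simp

theorem integrable_pow_of_compl_sphere {μ : Measure ℂ} [IsFiniteMeasure μ]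
    (h : μ (Metric.sphere (0 : ℂ) 1)ᶜ = 0) (n : ℕ) : Integrable (fun z : ℂ => z ^ n) μ := by
  refine Integrable.of_bound (by fun_prop) 1 ?_
  have : ∀ᵐ z ∂μ, z ∈ Metric.sphere (0 : ℂ) 1 := h
  filter_upwards [this] with z hz
  rw [norm_pow, mem_sphere_zero_iff_norm.1 hz, one_pow]

theorem integral_pow_acPart (κ : ℝ) (n : ℕ) :
    ∫ z, z ^ n ∂acPart κ = (2 * Real.pi : ℂ)⁻¹ *
      ∫ ψ in Ioc (-Real.pi) Real.pi, density κ ψ • Complex.exp (ψ * Complex.I) ^ n := by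
  rw [acPart, integral_map measurable_expAngle.aemeasurable (by fun_prop),
    integral_withDensity_eq_integral_toReal_smul (measurable_density κ).ennreal_ofReal
      (ae_of_all _ fun _ => ENNReal.ofReal_lt_top), angleMeasure, integral_smul_measure,
    ENNReal.toReal_ofReal (by positivity)]
  simp only [ENNReal.toReal_ofReal (density_nonneg κ _), Complex.real_smul]
  push_cast
  rfl

theorem setIntegral_density_exp_neg (κ : ℝ) (n : ℕ) :
    ∫ ψ in Ioc (-Real.pi) Real.pi, density κ ψ • Complex.exp (-(ψ * Complex.I)) ^ n =
      ∫ ψ in Ioc (-Real.pi) Real.pi, density κ ψ • Complex.exp (ψ * Complex.I) ^ n := by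
  have hpi : -Real.pi ≤ Real.pi := by linarith [Real.pi_pos]
  rw [← intervalIntegral.integral_of_le hpi, ← intervalIntegral.integral_of_le hpi]
  have h := intervalIntegral.integral_comp_neg (a := -Real.pi) (b := Real.pi)
    (fun ψ : ℝ => density κ ψ • Complex.exp (ψ * Complex.I) ^ n)
  simpa [density_neg] using h

/-- The model is invariant under conjugation, so twice its moment is the integral of `zⁿ + z⁻ⁿ`, a
Dickson polynomial of parameter 1 in `2 Re z`. -/
theorem two_mul_integral_pow (κ : ℝ) (n : ℕ) :
    2 * ∫ z, z ^ n ∂(atomPart κ + acPart κ) =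
      modelFunctional κ ((dickson 1 1 n).comp (X - C (2 * (κ : ℂ) ^ 2))) := by
  have hatom : ∫ z, z ^ n ∂atomPart κ = |κ| := by
    rw [atomPart, integral_smul_measure, integral_dirac, one_pow,
      ENNReal.toReal_ofReal (abs_nonneg κ)]
    simp
  have h2 : (dickson 1 (1 : ℂ) n).eval 2 = 2 := by
    have := eval_add_dickson_one (one_mul (1 : ℂ)) n
    rw [one_pow] at this
    norm_num at this
    exact this
  have hcos : ∀ ψ : ℝ, (dickson 1 (1 : ℂ) n).eval (2 * (Real.cos ψ : ℂ)) =
      Complex.exp (ψ * Complex.I) ^ n + Complex.exp (-(ψ * Complex.I)) ^ n := by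
    intro ψ
    rw [← eval_add_dickson_one (by rw [← Complex.exp_add, add_neg_cancel, Complex.exp_zero]) n,
      Complex.ofReal_cos, Complex.cos, neg_mul]
    ring_nf
  rw [integral_add_measure (integrable_pow_of_compl_sphere (atomPart_compl_sphere κ) n)
    (integrable_pow_of_compl_sphere (acPart_compl_sphere κ) n), hatom, integral_pow_acPart]
  simp only [modelFunctional, LinearMap.coe_mk, AddHom.coe_mk, eval_comp, eval_sub, eval_X, eval_C,
    add_sub_cancel_right, h2, hcos, smul_add]
  rw [integral_add (integrableOn_density_smul (by fun_prop) _ _)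
    (integrableOn_density_smul (by fun_prop) _ _), setIntegral_density_exp_neg]
  ring

/-! ### Determinacy of moments and conclusion -/

/-- A finite measure carried by the unit circle is determined by its moments. -/
theorem measure_ext_of_integral_pow {μ ν : Measure ℂ} [IsFiniteMeasure μ] [IsFiniteMeasure ν]
    (hμ : μ (Metric.sphere (0 : ℂ) 1)ᶜ = 0) (hν : ν (Metric.sphere (0 : ℂ) 1)ᶜ = 0)
    (h : ∀ n : ℕ, ∫ z, z ^ n ∂μ = ∫ z, z ^ n ∂ν) : μ = ν := by
  set K := Metric.sphere (0 : ℂ) 1 with hK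
  have hKm : MeasurableSet K := Metric.isClosed_sphere.measurableSet
  -- On the circle the inverse is the conjugate, so negative moments come for free.
  have hz : ∀ k : ℤ, ∫ z, z ^ k ∂μ = ∫ z, z ^ k ∂ν := by
    have hneg : ∀ (ρ : Measure ℂ), ρ Kᶜ = 0 → ∀ n : ℕ,
        ∫ z, z ^ (-(n : ℤ)) ∂ρ = (starRingEnd ℂ) (∫ z, z ^ n ∂ρ) := by
      intro ρ hρ n
      rw [← integral_conj]
      have hρ' : ∀ᵐ z ∂ρ, z ∈ K := hρ
      refine integral_congr_ae ?_
      filter_upwards [hρ'] with z hz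
      rw [zpow_neg, zpow_natCast, ← inv_pow, map_pow,
        Complex.inv_eq_conj (mem_sphere_zero_iff_norm.1 hz)]
    intro k
    obtain ⟨n, rfl | rfl⟩ := k.eq_nat_or_neg
    · simpa using h n
    · rw [hneg μ hμ, hneg ν hν, h]
  have hmap : ∀ ρ : Measure ℂ, ρ Kᶜ = 0 → (ρ.comap ((↑) : K → ℂ)).map (↑) = ρ := by
    intro ρ hρ
    rw [map_comap_subtype_coe hKm]
    exact Measure.restrict_eq_self_of_ae_mem hρ
  have hint : ∀ ρ : Measure ℂ, ρ Kᶜ = 0 → ∀ k : ℤ,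
      ∫ x : K, (x : ℂ) ^ k ∂(ρ.comap ((↑) : K → ℂ)) = ∫ z, z ^ k ∂ρ := by
    intro ρ hρ k
    rw [integral_subtype_comap hKm (fun z : ℂ => z ^ k),
      Measure.restrict_eq_self_of_ae_mem (s := K) hρ]
  have hfin : ∀ ρ : Measure ℂ, IsFiniteMeasure ρ →
      IsFiniteMeasure (ρ.comap ((↑) : K → ℂ)) := fun ρ _ => inferInstance
  have := hfin μ inferInstance
  have := hfin ν inferInstance
  let f : BoundedContinuousFunction K ℂ :=
    BoundedContinuousFunction.mkOfCompact ⟨Subtype.val, continuous_subtype_val⟩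
  have hf : ∀ x : K, f x = x := fun _ => rfl
  have hmon : ∀ g ∈ Submonoid.closure ({f} ∪ star {f} : Set (BoundedContinuousFunction K ℂ)),
      ∃ k : ℤ, ∀ x : K, g x = (x : ℂ) ^ k := by
    intro g hg
    induction hg using Submonoid.closure_induction with
    | one => exact ⟨0, fun x => by simp⟩
    | mul g g' _ _ hg hg' =>
      obtain ⟨k, hk⟩ := hg
      obtain ⟨k', hk'⟩ := hg'
      refine ⟨k + k', fun x => ?_⟩
      have hx : (x : ℂ) ≠ 0 := ne_zero_of_mem_unit_sphere x
      rw [BoundedContinuousFunction.mul_apply, hk, hk', zpow_add₀ hx]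
    | mem g hg =>
      rcases hg with rfl | hg
      · exact ⟨1, fun x => by rw [hf, zpow_one]⟩
      · rw [Set.star_singleton, Set.mem_singleton_iff] at hg
        refine ⟨-1, fun x => ?_⟩
        rw [hg, BoundedContinuousFunction.star_apply, hf, zpow_neg_one,
          Complex.inv_eq_conj (mem_sphere_zero_iff_norm.1 x.2)]
        rfl
  -- The coordinate `f` separates points, and the ⋆-algebra it generates is spanned by the monomials
  -- `z ^ k`, `k ∈ ℤ`.
  have key : μ.comap ((↑) : K → ℂ) = ν.comap ((↑) : K → ℂ) := by
    refine ext_of_forall_mem_subalgebra_integral_eq_of_polish (𝕜 := ℂ)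
      (A := StarAlgebra.adjoin ℂ {f}) ?_ ?_
    · intro x y hxy
      refine ⟨f, ⟨BoundedContinuousFunction.toContinuousMapStarₐ ℂ f,
        ⟨f, StarAlgebra.self_mem_adjoin_singleton ℂ f, rfl⟩, rfl⟩, ?_⟩
      rw [hf, hf]
      exact fun h => hxy (Subtype.ext h)
    · intro g hg
      have hg' : g ∈ Submodule.span ℂ
          (Submonoid.closure ({f} ∪ star {f} : Set (BoundedContinuousFunction K ℂ)) :
            Set (BoundedContinuousFunction K ℂ)) := by
        rw [← StarAlgebra.adjoin_eq_span]; exact hg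
      clear hg
      induction hg' using Submodule.span_induction with
      | zero => simp
      | smul c g hs ih =>
        simp only [BoundedContinuousFunction.coe_smul, integral_smul, ih]
      | add g g' hs hs' ih ih' =>
        simp only [BoundedContinuousFunction.coe_add, Pi.add_apply]
        rw [integral_add (g.integrable _) (g'.integrable _),
          integral_add (g.integrable _) (g'.integrable _), ih, ih']
      | mem g hs =>
        obtain ⟨k, hk⟩ := hmon g hs
        simp only [hk]
        rw [hint μ hμ, hint ν hν, hz]
  rw [← hmap μ hμ, ← hmap ν hν, key]

theorem isSpectralDistribution_iff {A : Type*} [CStarAlgebra A] {τ : A →ₗ[ℂ] ℂ} {w : A}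
    (hone : τ 1 = 1) (hw : w ∈ unitary A) {μ : Measure ℂ} [IsFiniteMeasure μ]
    (hμ : μ (Metric.sphere (0 : ℂ) 1)ᶜ = 0) (hmom : ∀ n : ℕ, ∫ z, z ^ n ∂μ = τ (w ^ n))
    (ν : Measure ℂ) : IsSpectralDistribution τ w ν ↔ ν = μ := by
  constructor
  · intro h
    have := h.isProbabilityMeasure
    exact measure_ext_of_integral_pow h.circle hμ fun n => by rw [h.moments, hmom]
  · rintro rfl
    refine ⟨hw, ⟨?_⟩, hμ, hmom⟩
    -- The zeroth moment forces total mass 1.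
    have h0 := hmom 0
    simp only [pow_zero, hone, integral_const, mul_one, Complex.real_smul] at h0
    have h1 : ν.real Set.univ = 1 := by exact_mod_cast h0
    rwa [measureReal_def, ENNReal.toReal_eq_one_iff] at h1

theorem symmetry_mul_self {A : Type*} [CStarAlgebra A] {P : A} (hP : IsStarProjection P) :
    (2 * P - 1) * (2 * P - 1) = 1 := by
  calc (2 * P - 1) * (2 * P - 1) = 4 * (P * P) - 4 * P + 1 := by noncomm_ring
    _ = 1 := by rw [hP.isIdempotentElem.eq]; noncomm_ring

theorem integral_pow_model_eq_trace {A : Type*} [CStarAlgebra A] {τ : A →ₗ[ℂ] ℂ}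
    (hτ : IsFaithfulTracialState τ) {P : A} (hP : IsStarProjection P) {U : unitary A}
    (hU : IsHaarUnitary τ U) (hfree : IsStarFree τ P (U : A)) {κ : ℝ}
    (hκ : τ (2 * P - 1) = (κ : ℂ)) (n : ℕ) :
    ∫ z, z ^ n ∂(atomPart κ + acPart κ) =
      τ (((2 * P - 1) * ((U : A) * (2 * P - 1) * star (U : A))) ^ n) := by
  obtain ⟨S, hSdef⟩ : ∃ S, S = 2 * P - 1 := ⟨_, rfl⟩
  have hκ1 := hτ.abs_trace_symmetry_le_one hP hκ
  rw [← hSdef] at hκ ⊢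
  have hUU : star (U : A) * U = 1 := Unitary.coe_star_mul_self U
  have hUU' : (U : A) * star (U : A) = 1 := Unitary.coe_mul_star_self U
  have hS : S * S = 1 := by rw [hSdef, symmetry_mul_self hP]
  have hconj : ∀ a b : A, (U : A) * a * star (U : A) * (U * b * star (U : A)) =
      U * (a * b) * star (U : A) := by
    intro a b
    calc _ = (U : A) * a * (star (U : A) * U) * b * star (U : A) := by simp only [mul_assoc]
      _ = _ := by rw [hUU, mul_one]; simp only [mul_assoc]
  have hT : (U : A) * S * star (U : A) * (U * S * star (U : A)) = 1 := by
    rw [hconj, hS, mul_one, hUU']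
  have hτT : τ ((U : A) * S * star (U : A)) = κ := by
    rw [hτ.tracial, ← mul_assoc, hUU, one_mul, hκ]
  -- Centring commutes with conjugation by `U`, which puts `(S - κ)(T - κ)` in the form required by
  -- `trace_alternating_pow`.
  have hcenter : (U : A) * S * star (U : A) - algebraMap ℂ A κ =
      U * (S - algebraMap ℂ A κ) * star (U : A) := by
    rw [mul_sub, sub_mul, ← Algebra.commutes, mul_assoc (algebraMap ℂ A κ), hUU',
      mul_one]
  have hmem : S - algebraMap ℂ A κ ∈ StarAlgebra.adjoin ℂ {P} := by
    have hPm := StarAlgebra.self_mem_adjoin_singleton ℂ P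
    rw [hSdef, two_mul]
    exact sub_mem (sub_mem (add_mem hPm hPm) (one_mem _)) (algebraMap_mem _ _)
  have hτ0 : τ (S - algebraMap ℂ A κ) = 0 := by
    rw [map_sub, hκ, Algebra.algebraMap_eq_smul_one, map_smul, hτ.map_one, smul_eq_mul, mul_one,
      sub_self]
  have hfree' : ∀ n : ℕ, τ (((S - algebraMap ℂ A κ) *
      ((U : A) * S * star (U : A) - algebraMap ℂ A κ)) ^ (n + 1)) = 0 := by
    intro n
    rw [hcenter]
    exact hfree.trace_alternating_pow hU hmem hτ0 n
  have h := two_mul_trace_mul_pow hτ.tracial hτ.map_one hS hT hκ hτT hfree' (modelFunctional κ)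
    (modelFunctional_dickson hκ1) n
  rw [← two_mul_integral_pow] at h
  exact (mul_left_cancel₀ two_ne_zero h).symm

theorem symmetry_mem_unitary {A : Type*} [CStarAlgebra A] {P : A} (hP : IsStarProjection P) :
    2 * P - 1 ∈ unitary A := by
  have hs : star (2 * P - 1) = 2 * P - 1 := by
    rw [two_mul, star_sub, star_add, hP.isSelfAdjoint.star_eq, star_one]
  rw [Unitary.mem_iff, hs]
  exact ⟨symmetry_mul_self hP, symmetry_mul_self hP⟩

end FreeProb

theorem mainTheorem7 {A : Type*} [CStarAlgebra A] [WStarAlgebra A]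
    (τ : A →ₗ[ℂ] ℂ) (hτ : FreeProb.IsFaithfulTracialState τ)
    (P S : A) (hP : IsStarProjection P) (hS : S = 2 * P - 1)
    (U : unitary A) (hU : FreeProb.IsHaarUnitary τ U)
    (hfree : FreeProb.IsStarFree τ P (U : A))
    (κ : ℝ) (hκ : τ S = (κ : ℂ)) :
    (∀ μ : Measure ℂ,
      FreeProb.IsSpectralDistribution τ (S * (U : A) * S * star (U : A)) μ ↔
        μ = FreeProb.atomPart κ + FreeProb.acPart κ) ∧
    FreeProb.acPart κ ≪ FreeProb.circleHaar ∧
    FreeProb.atomPart κ ⟂ₘ FreeProb.circleHaar ∧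
    FreeProb.acPart κ (FreeProb.arcs κ)ᶜ = 0 := by
  subst hS
  refine ⟨?_, FreeProb.acPart_absolutelyContinuous κ, FreeProb.atomPart_mutuallySingular κ,
    FreeProb.acPart_compl_arcs (hτ.abs_trace_symmetry_le_one hP hκ)⟩
  have hSu := FreeProb.symmetry_mem_unitary hP
  refine FreeProb.isSpectralDistribution_iff hτ.map_one
    (mul_mem (mul_mem (mul_mem hSu U.2) hSu) (Unitary.star_mem U.2)) ?_ fun n => ?_
  · rw [Measure.add_apply, FreeProb.atomPart_compl_sphere, FreeProb.acPart_compl_sphere, add_zero]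
  · rw [FreeProb.integral_pow_model_eq_trace hτ hP hU hfree hκ]
    simp only [mul_assoc]
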